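/- For every integer $p \ge 1$ let $G_{5,p}$ be the graph with vertex set $\{0,1,\dots,5p-3\}$ in which, with arithmetic modulo $5p-2$, the neighborhood of each vertex $i$ is $$N(i)=\{i-1,\,i+1\}\cup\{\,i+5j-1 : 1\le j\le p-1\,\}.$$ A graph $G$ is a minimal obstruction to $C_5$-coloring if $G$ has no homomorphism to the $5$-cycle $C_5$, but every proper induced subgraph of $G$ has one. Let $P_t$ be the path on $t$ vertices, and let $S_{a,b,c}$ be the graph obtained from paths on $a+1$, $b+1$ and $c+1$ vertices by identifying one endvertex of each; a graph is $F$-free if it does not contain $F$ as an induced subgraph. Then the graphs $G_{5,p}$, $p\ge 1$, form an infinite family of pairwise non-isomorphic minimal obstructions to $C_5$-coloring, and each of them is simultaneously $P_{13}$-free, $S_{2,2,2}$-free, $S_{5,5,1}$-free, $S_{11,1,1}$-free and $S_{8,2,1}$-free. -/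

import Mathlib

/-- A graph `G` is a *minimal obstruction to `H`-coloring* if `G` has no homomorphism to `H`,
but every proper induced subgraph of `G` has one. -/
def IsMinimalObstruction {V W : Type*} (H : SimpleGraph W) (G : SimpleGraph V) : Prop :=
  IsEmpty (G →g H) ∧ ∀ U : Set V, U ≠ Set.univ → Nonempty (G.induce U →g H)

/-- `G` is *`F`-free* if it does not contain `F` as an induced subgraph. -/
def IsInducedFree {V W : Type*} (F : SimpleGraph W) (G : SimpleGraph V) : Prop :=
  ¬ F.IsIndContained G

/-- The *subdivided claw* `S_{a,b,c}`, obtained from paths on `a + 1`, `b + 1` and `c + 1` vertices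
by identifying one endvertex of each: `none` is the common vertex, and the three summands hold the
remaining vertices of the three paths, in the order in which they follow the common vertex. -/
def subdividedClaw (a b c : ℕ) : SimpleGraph (Option (Fin a ⊕ Fin b ⊕ Fin c)) :=
  SimpleGraph.fromRel fun x y =>
    match x, y with
    | none, some (.inl j) => j.val = 0
    | none, some (.inr (.inl j)) => j.val = 0
    | none, some (.inr (.inr j)) => j.val = 0
    | some (.inl i), some (.inl j) => i.val + 1 = j.val
    | some (.inr (.inl i)), some (.inr (.inl j)) => i.val + 1 = j.val
    | some (.inr (.inr i)), some (.inr (.inr j)) => i.val + 1 = j.val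
    | _, _ => False

/-- The set `N(i) = {i - 1, i + 1} ∪ {i + q j - 1 | 1 ≤ j ≤ p - 1}`, computed modulo `q p - 2`. -/
def obstructionNeighbors (q p : ℕ) (i : ZMod (q * p - 2)) : Set (ZMod (q * p - 2)) :=
  {i - 1, i + 1} ∪ {k | ∃ j : ℕ, 1 ≤ j ∧ j + 1 ≤ p ∧ k = i + (q : ZMod (q * p - 2)) * j - 1}

/-- The graph `G_{q,p}` with vertex set `{0, …, q p - 3}` (the integers modulo `q p - 2`) in which
the neighborhood of `i` is `N(i)`. -/
def obstructionGraph (q p : ℕ) : SimpleGraph (ZMod (q * p - 2)) :=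
  SimpleGraph.fromRel fun i k => k ∈ obstructionNeighbors q p i

/-- The neighborhoods in `G_{q,p}` are exactly the sets `N(i)`. -/
theorem neighborSet_obstructionGraph (q p : ℕ) (hq : 3 ≤ q) (hqp : 4 ≤ q * p)
    (i : ZMod (q * p - 2)) :
    (obstructionGraph q p).neighborSet i = obstructionNeighbors q p i := by
  have hz : (q : ZMod (q * p - 2)) * p = 2 := by
    have h : ((q * p - 2 : ℕ) : ZMod (q * p - 2)) = 0 := ZMod.natCast_self _
    rw [Nat.cast_sub (by omega)] at h
    push_cast at h
    linear_combination h
  have hsymm : ∀ a b : ZMod (q * p - 2),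
      a ∈ obstructionNeighbors q p b → b ∈ obstructionNeighbors q p a := by
    rintro a b ((rfl | rfl) | ⟨j, h1, h2, rfl⟩)
    · exact Or.inl (Or.inr (by simp))
    · exact Or.inl (Or.inl (by simp))
    · refine Or.inr ⟨p - j, by omega, by omega, ?_⟩
      rw [Nat.cast_sub (by omega)]
      linear_combination -hz
  have hirr : ∀ a b : ZMod (q * p - 2), a ∈ obstructionNeighbors q p b → b ≠ a := by
    have : Fact (1 < q * p - 2) := ⟨by omega⟩
    rintro a b h rfl
    rcases h with (h | h) | ⟨j, h1, h2, h⟩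
    · exact one_ne_zero (α := ZMod (q * p - 2)) (by linear_combination h)
    · have h' : b = b + 1 := h
      exact one_ne_zero (α := ZMod (q * p - 2)) (by linear_combination -h')
    · have h0 : ((q * j - 1 : ℕ) : ZMod (q * p - 2)) = 0 := by
        rw [Nat.cast_sub (by nlinarith)]
        push_cast
        linear_combination -h
      rw [ZMod.natCast_eq_zero_iff] at h0
      have h3 : q * j + q ≤ q * p := by nlinarith
      have h4 : 3 ≤ q * j := by nlinarith
      have := Nat.le_of_dvd (by omega) h0
      omega
  ext k
  simp only [SimpleGraph.mem_neighborSet, obstructionGraph, SimpleGraph.fromRel_adj]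
  exact ⟨fun h => h.2.elim id (hsymm _ _), fun h => ⟨hirr _ _ h, Or.inl h⟩⟩

/-! Count positions from a vertex `c`. Every edge avoiding `c` joins positions that differ by ±1
modulo 5, so position modulo 5 colors G_{5,p} - c. The whole graph is a triangle if p = 1. If p ≥ 2,
then i, …, i+4 is a 5-cycle, and a homomorphism C_5 → C_5 has constant step ±1; going once around
makes 5p - 2 ≡ 3 equal steps, which do not sum to 0 modulo 5.

Each forbidden F has a leaf, while G_{5,p} has minimum degree at least 2. An induced copy of F
therefore misses a vertex and lives in the integer graph `IntAdj`, which does not depend on p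
(`obstructionGraph_adj_iff`, `isInducedFree_of_noExtension`). Once residues modulo 5 are fixed, each
adjacency or non-adjacency is impossible, automatic, or an inequality x + w ≤ y; a cycle of positive
total weight is a contradiction. `noExtension` places the vertices of F one by one, branching over
residues, and `not_extends_of_noExtension` shows this search sound. -/

/-! ### Induced trees in the integer graph -/

/-- The arcs `x → y` with `y ∈ {x - 1, x + 4, x + 9, …}`. Forgetting orientations gives a graph on
the integers that contains `G_{5,p} - v` as an induced subgraph. -/
def IntArc (x y : ℤ) : Prop := 5 ∣ y - x + 1 ∧ x ≤ y + 1

/-- Adjacency of integers along an `IntArc`. -/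
def IntAdj (x y : ℤ) : Prop := IntArc x y ∨ IntArc y x

/-- The list of length `n` whose only `true` is at index `o`. -/
def flags (o n : ℕ) : List Bool := (List.range n).map (· == o)

/-- The list of points `xs` can be extended by points, one for each entry of the given list, each
adjacent to exactly one of its predecessors, namely the one at the given index (the most recent
point has index `0`). -/
def Extends {α : Type*} (r : α → α → Prop) : List ℕ → List α → Prop
  | [], _ => True
  | o :: os, xs =>
    ∃ y, List.Forall₂ (fun b x => b = true ↔ r x y) (flags o xs.length) xs ∧
      Extends r os (y :: xs)

theorem Extends.map {α β : Type*} {r : α → α → Prop} {s : β → β → Prop} (f : α → β)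
    (hf : ∀ a b, s (f a) (f b) ↔ r a b) :
    ∀ (os : List ℕ) (xs : List α), Extends r os xs → Extends s os (xs.map f)
  | [], _, _ => trivial
  | o :: os, xs, ⟨y, hy, h⟩ => by
    refine ⟨f y, ?_, by simpa using Extends.map f hf os (y :: xs) h⟩
    simpa [List.forall₂_map_right_iff, hf] using hy

/-! ### Difference bounds -/

/-- For points `x ≡ c` and `y ≡ d` modulo `5`, adjacent or not as told by `b`, a number `w` with
`x + w ≤ y`, if there is one. -/
def lowerBound (d : ℕ) (b : Bool) (c : ℕ) : Option ℤ :=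
  if (d + 1) % 5 = c then (if b then some (-1) else none)
  else if (c + 1) % 5 = d then (if b then none else some 6) else none

/-- `none` plays the role of -∞: these are the max-plus operations, which compute longest paths. -/
def optAdd : Option ℤ → Option ℤ → Option ℤ
  | some a, some b => some (a + b)
  | _, _ => none

def optMax : Option ℤ → Option ℤ → Option ℤ
  | some a, some b => some (if a ≤ b then b else a)
  | some a, none => some a
  | none, b => b

def isPos : Option ℤ → Bool
  | some a => decide (0 < a)
  | none => false

/-- `b` is a valid lower bound for `y - x`. -/
def IsBound (x : ℤ) (b : Option ℤ) (y : ℤ) : Prop := ∀ w, b = some w → x + w ≤ y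

theorem IsBound.add {x y z : ℤ} {a b : Option ℤ} (h : IsBound x a y) (h' : IsBound y b z) :
    IsBound x (optAdd a b) z := by
  intro w hw
  cases a <;> cases b <;> simp [optAdd] at hw
  have := h _ rfl
  have := h' _ rfl
  omega

theorem IsBound.max {x y : ℤ} {a b : Option ℤ} (h : IsBound x a y) (h' : IsBound x b y) :
    IsBound x (optMax a b) y := by
  intro w hw
  cases a <;> cases b <;> simp [optMax] at hw
  · exact h' _ (by simp [hw])
  · exact h _ (by simp [hw])
  · have := h _ rfl
    have := h' _ rfl
    split at hw <;> omega

theorem IsBound.not_isPos {x : ℤ} {a : Option ℤ} (h : IsBound x a x) : isPos a = false := by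
  cases a with
  | none => rfl
  | some a => have := h _ rfl; simp [isPos]; omega

/-- The best bound obtained by composing the bounds in `r` with those in `s`. -/
def compose : List (Option ℤ) → List (Option ℤ) → Option ℤ
  | a :: r, b :: s => optMax (optAdd a b) (compose r s)
  | _, _ => none

theorem isBound_compose {x z : ℤ} : ∀ {r s : List (Option ℤ)} {xs : List ℤ},
    List.Forall₂ (IsBound x) r xs → List.Forall₂ (fun b y => IsBound y b z) s xs →
    IsBound x (compose r s) z
  | _, _, _, .nil, .nil => by simp [IsBound, compose]
  | _, _, _, .cons h t, .cons h' t' => (h.add h').max (isBound_compose t t')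

/-- The bounds obtained by composing the bounds in `s` with the rows of `D`. -/
def composeRows (n : ℕ) : List (Option ℤ) → List (List (Option ℤ)) → List (Option ℤ)
  | b :: s, r :: D => List.zipWith optMax (r.map (optAdd b)) (composeRows n s D)
  | _, _ => List.replicate n none

theorem forall₂_zipWith {α β γ δ : Type*} {R : α → δ → Prop} {S : β → δ → Prop} {T : γ → δ → Prop}
    {f : α → β → γ} (hf : ∀ a b d, R a d → S b d → T (f a b) d) :
    ∀ {as : List α} {bs : List β} {ds : List δ}, List.Forall₂ R as ds → List.Forall₂ S bs ds →
      List.Forall₂ T (List.zipWith f as bs) ds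
  | _, _, _, .nil, .nil => .nil
  | _, _, _, .cons h t, .cons h' t' => .cons (hf _ _ _ h h') (forall₂_zipWith hf t t')

theorem isBound_composeRows {y : ℤ} {ys : List ℤ} :
    ∀ {s : List (Option ℤ)} {D : List (List (Option ℤ))} {xs : List ℤ},
    List.Forall₂ (IsBound y) s xs → List.Forall₂ (fun r x => List.Forall₂ (IsBound x) r ys) D xs →
    List.Forall₂ (IsBound y) (composeRows ys.length s D) ys
  | _, _, _, .nil, .nil => by
    simp only [composeRows]
    induction ys with
    | nil => exact .nil
    | cons a l ih => exact .cons (by simp [IsBound]) ih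
  | _, _, _, .cons h t, .cons h' t' => by
    refine forall₂_zipWith (fun _ _ _ => IsBound.max) ?_ (isBound_composeRows t t')
    rw [List.forall₂_map_left_iff]
    exact h'.imp fun _ _ h'' => h.add h''

/-! ### The search over residues -/

/-- `b` tells whether a vertex of class `c` and one of class `d` are adjacent: is this possible? -/
def compatible (d : ℕ) (b : Bool) (c : ℕ) : Bool :=
  !b || (d + 1) % 5 == c || (c + 1) % 5 == d

/-- Bounds for one more point in front, from bounds `inn` and `out` from and to the others. -/
def extendBounds (D : List (List (Option ℤ))) (inn out : List (Option ℤ)) :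
    List (List (Option ℤ)) :=
  (some 0 :: out) :: List.zipWith (fun r a => a :: List.zipWith optMax r (out.map (optAdd a))) D inn

theorem forall₂_extendBounds {y : ℤ} {xs : List ℤ} {D : List (List (Option ℤ))}
    {inn out : List (Option ℤ)} (hD : List.Forall₂ (fun r x => List.Forall₂ (IsBound x) r xs) D xs)
    (hi : List.Forall₂ (fun b x => IsBound x b y) inn xs)
    (ho : List.Forall₂ (IsBound y) out xs) :
    List.Forall₂ (fun r x => List.Forall₂ (IsBound x) r (y :: xs)) (extendBounds D inn out)
      (y :: xs) := by
  refine .cons (.cons (by simp [IsBound]) ho) (forall₂_zipWith ?_ hD hi)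
  intro r a x hr ha
  refine .cons ha (forall₂_zipWith (fun _ _ _ => IsBound.max) hr ?_)
  rw [List.forall₂_map_left_iff]
  exact ho.imp fun _ _ h => ha.add h

/-- Searches through the residues modulo `5` of the points of an extension as in `Extends`, where
`cs` lists the residues of the present points and `D` valid bounds for their differences. The value
is `true` if each choice leads to contradicting bounds. -/
def noExtension : List ℕ → List ℕ → List (List (Option ℤ)) → Bool
  | [], _, _ => false
  | o :: os, cs, D => (List.range 5).all fun d =>
    !((List.zipWith (compatible d) (flags o cs.length) cs).all id) ||
    (fun inn out => (List.zipWith optAdd inn out).any isPos ||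
      noExtension os (d :: cs) (extendBounds D inn out))
    (D.map fun r => compose r (List.zipWith (lowerBound d) (flags o cs.length) cs))
    (composeRows cs.length
      (List.zipWith (fun b c => lowerBound c b d) (flags o cs.length) cs) D)

/-- `c` is the residue of `x - r` modulo `5`. -/
def IsResidue (r : ℤ) (c : ℕ) (x : ℤ) : Prop := (x - r) % 5 = c

/-- If y ≡ x - 1, adjacency means y ≥ x - 1. If y ≡ x + 1, it means y ≤ x + 1, so non-adjacent y is
at least the next member of the class, x + 6. -/
theorem isBound_lowerBound {r x y : ℤ} {c d : ℕ} {b : Bool} (hx : IsResidue r c x)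
    (hy : IsResidue r d y) (hb : b = true ↔ IntAdj x y) : IsBound x (lowerBound d b c) y := by
  intro w hw
  unfold IsResidue at hx hy
  unfold IntAdj IntArc at hb
  unfold lowerBound at hw
  split_ifs at hw <;> simp at hw <;> simp_all <;> omega

theorem intAdj_comm {x y : ℤ} : IntAdj x y ↔ IntAdj y x := or_comm

/-- The residue of the new point selects a branch, which closes by an impossible adjacency, by a
positive cycle through the new point, or by recursion with the updated bounds. -/
theorem not_extends_of_noExtension (r : ℤ) : ∀ (os cs : List ℕ) (D : List (List (Option ℤ)))
    (xs : List ℤ), List.Forall₂ (IsResidue r) cs xs →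
    List.Forall₂ (fun r x => List.Forall₂ (IsBound x) r xs) D xs →
    noExtension os cs D = true → ¬ Extends IntAdj os xs
  | [], _, _, _, _, _, h => by simp [noExtension] at h
  | o :: os, cs, D, xs, hc, hD, h => by
    rintro ⟨y, hy, hext⟩
    have hlen : cs.length = xs.length := hc.length_eq
    rw [← hlen] at hy
    obtain ⟨d, hd⟩ : ∃ d : ℕ, (y - r) % 5 = d := ⟨((y - r) % 5).toNat, by omega⟩
    have hyd : IsResidue r d y := hd
    rw [noExtension, List.all_eq_true] at h
    have hd' := h d (by simp; omega)
    have hi : List.Forall₂ (fun b x => IsBound x b y)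
        (D.map fun r => compose r (List.zipWith (lowerBound d) (flags o cs.length) cs)) xs := by
      rw [List.forall₂_map_left_iff]
      refine hD.imp fun s x hs => isBound_compose hs ?_
      exact forall₂_zipWith (R := fun b x => b = true ↔ IntAdj x y) (S := IsResidue r)
        (T := fun b x => IsBound x b y)
        (fun b c x hb hx => isBound_lowerBound hx hyd hb) hy hc
    have ho : List.Forall₂ (IsBound y) (composeRows cs.length
        (List.zipWith (fun b c => lowerBound c b d) (flags o cs.length) cs) D) xs := by
      rw [hlen]
      refine isBound_composeRows ?_ hD
      rw [← hlen]
      exact forall₂_zipWith (R := fun b x => b = true ↔ IntAdj x y) (S := IsResidue r)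
        (fun b c x hb hx => isBound_lowerBound hyd hx (hb.trans intAdj_comm)) hy hc
    rw [Bool.or_eq_true, Bool.or_eq_true] at hd'
    rcases hd' with hd' | hd' | hd'
    · rw [Bool.not_eq_true', ← Bool.not_eq_true, List.all_eq_true] at hd'
      refine hd' ?_
      have : List.Forall₂ (fun b (_ : ℤ) => b = true)
          (List.zipWith (compatible d) (flags o cs.length) cs) xs := by
        refine forall₂_zipWith (fun b c x hb hx => ?_) hy hc
        cases b with
        | false => rfl
        | true =>
          have := hb.1 rfl
          simp only [compatible, Bool.not_true, Bool.false_or, Bool.or_eq_true, beq_iff_eq]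
          unfold IsResidue at hx
          unfold IntAdj IntArc at this
          omega
      intro b hb
      obtain ⟨i, hi, rfl⟩ := List.getElem_of_mem hb
      exact this.get hi (this.length_eq ▸ hi)
    · rw [List.any_eq_true] at hd'
      obtain ⟨b, hb, hb'⟩ := hd'
      have : List.Forall₂ (fun b (x : ℤ) => isPos b = false) _ xs :=
        forall₂_zipWith (f := optAdd) (fun a b x (h : IsBound x a y) (h' : IsBound y b x) =>
          (h.add h').not_isPos) hi ho
      obtain ⟨i, hi, rfl⟩ := List.getElem_of_mem hb
      have := this.get hi (this.length_eq ▸ hi)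
      simp_all
    · exact not_extends_of_noExtension r os (d :: cs) _ (y :: xs) (.cons hyd hc)
        (forall₂_extendBounds hD hi ho) hd' hext

/-- Residues are taken relative to the first point, so it may be given residue 0. -/
theorem not_extends_singleton {os : List ℕ} (h : noExtension os [0] [[some 0]] = true) (x : ℤ) :
    ¬ Extends IntAdj os [x] :=
  not_extends_of_noExtension x os _ _ _ (.cons (by simp [IsResidue]) .nil)
    (.cons (.cons (by simp [IsBound]) .nil) .nil) h

/-- The indices for `Extends` that describe the subdivided claw `S_{a+1,b+1,c+1}`. -/
def clawSteps (a b c : ℕ) : List ℕ :=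
  List.replicate (a + 1) 0 ++ (a + 1) :: List.replicate b 0 ++ (a + b + 2) :: List.replicate c 0

theorem noExtension_path : noExtension (List.replicate 12 0) [0] [[some 0]] = true := by
  decide +kernel

theorem noExtension_claw_two_two_two : noExtension (clawSteps 1 1 1) [0] [[some 0]] = true := by
  decide +kernel

theorem noExtension_claw_five_five_one : noExtension (clawSteps 4 4 0) [0] [[some 0]] = true := by
  decide +kernel

theorem noExtension_claw_eleven_one_one :
    noExtension (clawSteps 10 0 0) [0] [[some 0]] = true := by
  decide +kernel

theorem noExtension_claw_eight_two_one : noExtension (clawSteps 7 1 0) [0] [[some 0]] = true := by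
  decide +kernel

/-! ### From the cyclic graph to the integers -/

theorem neZero_five_mul_sub_two {p : ℕ} (hp : 1 ≤ p) : NeZero (5 * p - 2) := ⟨by omega⟩

theorem natCast_val_eq {n : ℕ} [NeZero n] (d : ZMod n) {m : ℕ} (hm : m < n) :
    d = m ↔ d.val = m := by
  constructor
  · rintro rfl
    exact ZMod.val_cast_of_lt hm
  · rintro rfl
    exact (ZMod.natCast_zmod_val d).symm

/-- The numbers 5j - 1 with 1 ≤ j ≤ p - 1 are exactly those below 5p - 2 that are 4 modulo 5. -/
theorem mem_obstructionNeighbors_iff {p : ℕ} (hp : 1 ≤ p) (i k : ZMod (5 * p - 2)) :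
    k ∈ obstructionNeighbors 5 p i ↔
      (k - i).val = 1 ∨ (k - i).val = 5 * p - 3 ∨ (k - i).val % 5 = 4 := by
  have := neZero_five_mul_sub_two hp
  have hlt := (k - i).val_lt
  have h1 : k = i + 1 ↔ (k - i).val = 1 := by
    rw [← natCast_val_eq (k - i) (by omega), sub_eq_iff_eq_add', Nat.cast_one]
  have h2 : k = i - 1 ↔ (k - i).val = 5 * p - 3 := by
    rw [← natCast_val_eq (k - i) (by omega), sub_eq_iff_eq_add']
    have : ((5 * p - 3 : ℕ) : ZMod (5 * p - 2)) = -1 := by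
      have h := ZMod.natCast_self (5 * p - 2)
      rw [show 5 * p - 2 = 5 * p - 3 + 1 by omega, Nat.cast_add, Nat.cast_one] at h
      rw [show 5 * p - 3 + 1 = 5 * p - 2 by omega] at h
      linear_combination h
    rw [this, sub_eq_add_neg]
  have h3 (j : ℕ) (hj : 1 ≤ j) (hj' : j + 1 ≤ p) :
      k = i + ((5 : ℕ) : ZMod (5 * p - 2)) * j - 1 ↔ (k - i).val = 5 * j - 1 := by
    rw [← natCast_val_eq (k - i) (by omega), sub_eq_iff_eq_add', Nat.cast_sub (by omega)]
    push_cast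
    rw [add_sub_assoc]
  simp only [obstructionNeighbors, Set.mem_union, Set.mem_insert_iff, Set.mem_singleton_iff,
    Set.mem_ofPred_eq, h1, h2]
  constructor
  · rintro ((h | h) | ⟨j, hj, hj', h⟩)
    · omega
    · omega
    · rw [h3 j hj hj'] at h
      omega
  · rintro (h | h | h)
    · tauto
    · tauto
    · refine Or.inr ⟨((k - i).val + 1) / 5, by omega, by omega, ?_⟩
      rw [h3 _ (by omega) (by omega)]
      omega

/-- The position of a vertex, counted from the vertex `c`. -/
def position {n : ℕ} (c a : ZMod n) : ℤ := ((a - c).val : ℕ)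

/-- Positions other than `c` lie in 1, …, 5p - 3, so the cyclic difference 1 never wraps around. The
class 4 modulo 5 is stable under d ↦ 5p - 2 - d, so wrapping does not affect the other edges. -/
theorem obstructionGraph_adj_iff {p : ℕ} (hp : 1 ≤ p) {a b c : ZMod (5 * p - 2)} (ha : a ≠ c)
    (hb : b ≠ c) : (obstructionGraph 5 p).Adj a b ↔ IntAdj (position c a) (position c b) := by
  have := neZero_five_mul_sub_two hp
  have key : ∀ a b : ZMod (5 * p - 2), a ≠ c → b ≠ c → a ≠ b →
      (b ∈ obstructionNeighbors 5 p a ↔ IntAdj (position c a) (position c b)) := by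
    intro a b ha hb hab
    have ha' : (a - c).val ≠ 0 := by rwa [Ne, ZMod.val_eq_zero, sub_eq_zero]
    have hb' : (b - c).val ≠ 0 := by rwa [Ne, ZMod.val_eq_zero, sub_eq_zero]
    have hab' : (b - a).val ≠ 0 := by rwa [Ne, ZMod.val_eq_zero, sub_eq_zero, eq_comm]
    have hadd := ZMod.val_add (b - a) (a - c)
    rw [sub_add_sub_cancel] at hadd
    have h1 := (a - c).val_lt
    have h2 := (b - c).val_lt
    have h3 := (b - a).val_lt
    have h4 : (b - c).val = (b - a).val + (a - c).val ∨
        (b - c).val + (5 * p - 2) = (b - a).val + (a - c).val := by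
      rcases lt_or_ge ((b - a).val + (a - c).val) (5 * p - 2) with h | h
      · rw [Nat.mod_eq_of_lt h] at hadd
        exact Or.inl hadd
      · rw [Nat.mod_eq_sub_mod h, Nat.mod_eq_of_lt (by omega)] at hadd
        omega
    rw [mem_obstructionNeighbors_iff hp]
    unfold IntAdj IntArc position
    omega
  rw [obstructionGraph, SimpleGraph.fromRel_adj]
  constructor
  · rintro ⟨hab, h | h⟩
    · exact (key a b ha hb hab).1 h
    · exact intAdj_comm.1 ((key b a hb ha hab.symm).1 h)
  · intro h
    have hab : a ≠ b := by
      rintro rfl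
      unfold IntAdj IntArc at h
      omega
    exact ⟨hab, Or.inl ((key a b ha hb hab).2 h)⟩

theorem obstructionGraph_adj_add_one {p : ℕ} (hp : 1 ≤ p) (a : ZMod (5 * p - 2)) :
    (obstructionGraph 5 p).Adj a (a + 1) := by
  have : Fact (1 < 5 * p - 2) := ⟨by omega⟩
  rw [obstructionGraph, SimpleGraph.fromRel_adj]
  exact ⟨by simp, Or.inl (Or.inl (Or.inr rfl))⟩

theorem obstructionGraph_adj_add_four {p : ℕ} (hp : 2 ≤ p) (a : ZMod (5 * p - 2)) :
    (obstructionGraph 5 p).Adj a (a + 4) := by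
  have := neZero_five_mul_sub_two (p := p) (by omega)
  have h4 : ((4 : ℕ) : ZMod (5 * p - 2)).val = 4 := ZMod.val_cast_of_lt (by omega)
  rw [Nat.cast_ofNat] at h4
  rw [obstructionGraph, SimpleGraph.fromRel_adj]
  refine ⟨fun h => ?_, Or.inl ?_⟩
  · have h0 : (4 : ZMod (5 * p - 2)) = 0 := by simpa using h.symm
    rw [h0, ZMod.val_zero] at h4
    omega
  · rw [mem_obstructionNeighbors_iff (by omega), add_sub_cancel_left, h4]
    omega

theorem isInducedFree_of_noExtension {W : Type*} {F : SimpleGraph W} {os : List ℕ} {x v w : W}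
    (hos : noExtension os [0] [[some 0]] = true) (hF : Extends F.Adj os [x])
    (hleaf : ∀ u, F.Adj v u → u = w) {p : ℕ} (hp : 1 ≤ p) :
    IsInducedFree F (obstructionGraph 5 p) := by
  rintro ⟨e⟩
  by_cases hsurj : Function.Surjective e
  · have hleaf' : ∀ u, (obstructionGraph 5 p).Adj (e v) u → u = e w := by
      intro u hu
      obtain ⟨u, rfl⟩ := hsurj u
      rw [hleaf u (e.map_adj_iff.1 hu)]
    have h1 := hleaf' _ (obstructionGraph_adj_add_one hp (e v))
    have h2 := hleaf' (e v - 1) (by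
      simpa using (obstructionGraph_adj_add_one hp (e v - 1)).symm)
    have h3 : ((2 : ℕ) : ZMod (5 * p - 2)) = 0 := by
      push_cast
      linear_combination h1 - h2
    rw [ZMod.natCast_eq_zero_iff] at h3
    have := Nat.le_of_dvd (by norm_num) h3
    omega
  · obtain ⟨c, hc⟩ := not_forall.1 hsurj
    have hc' (u : W) : e u ≠ c := fun h => hc ⟨u, h⟩
    refine not_extends_singleton hos (position c (e x)) ?_
    refine hF.map (fun u => position c (e u)) fun a b => ?_
    rw [← obstructionGraph_adj_iff hp (hc' a) (hc' b), e.map_adj_iff]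

/-! ### Minimality and non-isomorphism -/

theorem cycleGraph_five_adj_iff (a b : Fin 5) :
    (SimpleGraph.cycleGraph 5).Adj a b ↔ b - a = 1 ∨ b - a = 4 := by
  revert a b
  decide

/-- Five steps ±1 that close up modulo 5 all have the same sign; the fifth step is minus the sum of
the other four. -/
theorem steps_eq_of_sum : ∀ a b c d : Fin 5, (a = 1 ∨ a = 4) → (b = 1 ∨ b = 4) →
    (c = 1 ∨ c = 4) → (d = 1 ∨ d = 4) → (a + b + c + d = 1 ∨ a + b + c + d = 4) → a = b := by
  decide

theorem not_colorable_obstructionGraph {p : ℕ} (hp : 1 ≤ p) :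
    IsEmpty (obstructionGraph 5 p →g SimpleGraph.cycleGraph 5) := by
  refine ⟨fun f => ?_⟩
  have hs (a : ZMod (5 * p - 2)) : f (a + 1) - f a = 1 ∨ f (a + 1) - f a = 4 :=
    (cycleGraph_five_adj_iff _ _).1 (f.map_adj (obstructionGraph_adj_add_one hp a))
  rcases hp.eq_or_lt with rfl | hp2
  · have h0 := hs 0
    have h1 := hs 1
    have h2 := hs 2
    rw [show (0 : ZMod (5 * 1 - 2)) + 1 = 1 by decide] at h0
    rw [show (1 : ZMod (5 * 1 - 2)) + 1 = 2 by decide] at h1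
    rw [show (2 : ZMod (5 * 1 - 2)) + 1 = 0 by decide] at h2
    generalize f 0 = x at *
    generalize f 1 = y at *
    generalize f 2 = z at *
    revert x y z
    decide
  · have hstep (a : ZMod (5 * p - 2)) : f (a + 1) - f a = f (a + 1 + 1) - f (a + 1) := by
      refine steps_eq_of_sum _ _ _ _ (hs a) (hs (a + 1)) (hs (a + 1 + 1)) (hs (a + 1 + 1 + 1)) ?_
      have h := (cycleGraph_five_adj_iff _ _).1 (f.map_adj (obstructionGraph_adj_add_four hp2 a))
      rw [show a + 1 + 1 + 1 + 1 = a + 4 by ring]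
      convert h using 2 <;> abel
    have hconst (m : ℕ) : f (m + 1) - f m = f 1 - f 0 := by
      induction m with
      | zero => simp
      | succ m ih => rw [← ih, hstep m]; push_cast; rfl
    have hlin (m : ℕ) : f m = f 0 + m • (f 1 - f 0) := by
      induction m with
      | zero => simp
      | succ m ih =>
        rw [succ_nsmul, ← add_assoc, ← ih, ← hconst m]
        push_cast
        abel
    have h := hlin (5 * p - 2)
    rw [ZMod.natCast_self, left_eq_add] at h
    have h01 := hs 0
    rw [zero_add] at h01
    generalize f 1 - f 0 = x at h h01
    -- Multiples of 5 vanish in `Fin 5`, which leaves 3x = 0 for a step x = ±1.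
    rw [show 5 * p - 2 = (p - 1) * 5 + 3 by omega, add_nsmul,
      mul_nsmul] at h
    have h5 : ∀ x : Fin 5, 5 • x = 0 := by decide
    have h3 : ∀ x : Fin 5, (x = 1 ∨ x = 4) → 3 • x ≠ 0 := by decide
    simp only [h5, zero_add] at h
    exact h3 _ h01 h

theorem colorable_induce_obstructionGraph {p : ℕ} (hp : 1 ≤ p) (U : Set (ZMod (5 * p - 2)))
    (hU : U ≠ Set.univ) :
    Nonempty ((obstructionGraph 5 p).induce U →g SimpleGraph.cycleGraph 5) := by
  obtain ⟨c, hc⟩ := (Set.ne_univ_iff_exists_notMem U).1 hU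
  have hc' (u : U) : (u : ZMod (5 * p - 2)) ≠ c := fun h => hc (h ▸ u.2)
  refine ⟨⟨fun u => Fin.ofNat 5 ((u : ZMod (5 * p - 2)) - c).val, ?_⟩⟩
  intro a b hab
  have h := (obstructionGraph_adj_iff hp (hc' a) (hc' b)).1 hab
  rw [cycleGraph_five_adj_iff, Fin.ext_iff, Fin.ext_iff, Fin.sub_def]
  unfold IntAdj IntArc position at h
  simp only [Fin.ofNat]
  norm_num
  omega

theorem isMinimalObstruction_obstructionGraph {p : ℕ} (hp : 1 ≤ p) :
    IsMinimalObstruction (SimpleGraph.cycleGraph 5) (obstructionGraph 5 p) :=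
  ⟨not_colorable_obstructionGraph hp, colorable_induce_obstructionGraph hp⟩

theorem isEmpty_iso_obstructionGraph {p p' : ℕ} (hp : 1 ≤ p) (hp' : 1 ≤ p') (h : p ≠ p') :
    IsEmpty (obstructionGraph 5 p ≃g obstructionGraph 5 p') := by
  refine ⟨fun e => ?_⟩
  have := Nat.card_congr e.toEquiv
  rw [Nat.card_zmod, Nat.card_zmod] at this
  omega

/-! ### Vertex orders of the forbidden graphs -/

instance (n : ℕ) : DecidableRel (SimpleGraph.pathGraph n).Adj := fun _ _ =>
  decidable_of_iff _ SimpleGraph.pathGraph_adj.symm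

instance (a b c : ℕ) : DecidableRel (subdividedClaw a b c).Adj := fun x y => by
  unfold subdividedClaw
  rw [SimpleGraph.fromRel_adj]
  rcases x with _ | _ | _ | _ <;> rcases y with _ | _ | _ | _ <;> infer_instance

theorem extends_pathGraph : Extends (SimpleGraph.pathGraph 13).Adj (List.replicate 12 0) [0] :=
  ⟨1, by decide, 2, by decide, 3, by decide, 4, by decide, 5, by decide, 6, by decide, 7,
    by decide, 8, by decide, 9, by decide, 10, by decide, 11, by decide, 12, by decide,
    trivial⟩

theorem extends_claw_two_two_two :
    Extends (subdividedClaw 2 2 2).Adj (clawSteps 1 1 1) [none] :=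
  ⟨some (.inl 0), by decide, some (.inl 1), by decide, some (.inr (.inl 0)), by decide,
    some (.inr (.inl 1)), by decide, some (.inr (.inr 0)), by decide, some (.inr (.inr 1)),
    by decide, trivial⟩

theorem extends_claw_five_five_one :
    Extends (subdividedClaw 5 5 1).Adj (clawSteps 4 4 0) [none] :=
  ⟨some (.inl 0), by decide, some (.inl 1), by decide, some (.inl 2), by decide, some (.inl 3),
    by decide, some (.inl 4), by decide, some (.inr (.inl 0)), by decide, some (.inr (.inl 1)),
    by decide, some (.inr (.inl 2)), by decide, some (.inr (.inl 3)), by decide,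
    some (.inr (.inl 4)), by decide, some (.inr (.inr 0)), by decide, trivial⟩

theorem extends_claw_eleven_one_one :
    Extends (subdividedClaw 11 1 1).Adj (clawSteps 10 0 0) [none] :=
  ⟨some (.inl 0), by decide, some (.inl 1), by decide, some (.inl 2), by decide, some (.inl 3),
    by decide, some (.inl 4), by decide, some (.inl 5), by decide, some (.inl 6), by decide,
    some (.inl 7), by decide, some (.inl 8), by decide, some (.inl 9), by decide,
    some (.inl 10), by decide, some (.inr (.inl 0)), by decide, some (.inr (.inr 0)),
    by decide, trivial⟩

theorem extends_claw_eight_two_one :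
    Extends (subdividedClaw 8 2 1).Adj (clawSteps 7 1 0) [none] :=
  ⟨some (.inl 0), by decide, some (.inl 1), by decide, some (.inl 2), by decide, some (.inl 3),
    by decide, some (.inl 4), by decide, some (.inl 5), by decide, some (.inl 6), by decide,
    some (.inl 7), by decide, some (.inr (.inl 0)), by decide, some (.inr (.inl 1)), by decide,
    some (.inr (.inr 0)), by decide, trivial⟩

theorem theorem3 :
    (∀ p : ℕ, 1 ≤ p →
      IsMinimalObstruction (SimpleGraph.cycleGraph 5) (obstructionGraph 5 p) ∧
      IsInducedFree (SimpleGraph.pathGraph 13) (obstructionGraph 5 p) ∧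
      IsInducedFree (subdividedClaw 2 2 2) (obstructionGraph 5 p) ∧
      IsInducedFree (subdividedClaw 5 5 1) (obstructionGraph 5 p) ∧
      IsInducedFree (subdividedClaw 11 1 1) (obstructionGraph 5 p) ∧
      IsInducedFree (subdividedClaw 8 2 1) (obstructionGraph 5 p)) ∧
    (∀ p p' : ℕ, 1 ≤ p → 1 ≤ p' → p ≠ p' →
      IsEmpty (obstructionGraph 5 p ≃g obstructionGraph 5 p')) := by
  refine ⟨fun p hp => ⟨isMinimalObstruction_obstructionGraph hp, ?_, ?_, ?_, ?_, ?_⟩,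
    fun p p' hp hp' h => isEmpty_iso_obstructionGraph hp hp' h⟩
  · exact isInducedFree_of_noExtension (v := 0) (w := 1) noExtension_path extends_pathGraph
      (by decide) hp
  · exact isInducedFree_of_noExtension (v := some (.inr (.inr 1))) (w := some (.inr (.inr 0)))
      noExtension_claw_two_two_two extends_claw_two_two_two (by decide) hp
  · exact isInducedFree_of_noExtension (v := some (.inr (.inr 0))) (w := none)
      noExtension_claw_five_five_one extends_claw_five_five_one (by decide) hp
  · exact isInducedFree_of_noExtension (v := some (.inr (.inr 0))) (w := none)
      noExtension_claw_eleven_one_one extends_claw_eleven_one_one (by decide) hp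
  · exact isInducedFree_of_noExtension (v := some (.inr (.inr 0))) (w := none)
      noExtension_claw_eight_two_one extends_claw_eight_two_one (by decide) hp
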